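/- For $\alpha>0$ and $\beta\in\mathbb R$ let $E_{\alpha,\beta}(z)=\sum_{k=0}^\infty \frac{z^k}{\Gamma(\alpha k+\beta)}$ denote the Mittag-Leffler function. For every $\bar\ell\in(0,\infty)$, $\alpha_0\in(0,1)$ and $p\in[1,\frac{1}{1-\alpha_0})$ there exists a constant $\tilde C=\tilde C(\alpha_0,p,\bar\ell)>0$ such that for every $\lambda_1\ge 0$, every $\alpha\in[\alpha_0,1)$ and every $\lambda>\lambda_1$, the function $d_\alpha:[0,\bar\ell]\to\mathbb R$, $d_\alpha(t)=E_{\alpha,1}(-\lambda t^\alpha)-\exp(-\lambda t)$, belongs to $L^\infty(0,\bar\ell)$ and to $L^p(0,\bar\ell)$ and satisfies $$\|d_\alpha\|_{L^\infty(0,\bar\ell)}\le\tilde C\,\lambda^{1/p}(1-\alpha),\qquad \|d_\alpha\|_{L^p(0,\bar\ell)}\le\tilde C\,(1-\alpha).$$ In particular $\tilde C$ does not depend on $\alpha$, $\lambda$ or $\lambda_1$. -/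

import Mathlib

open MeasureTheory Set
open scoped ENNReal

/-- The two-parameter Mittag-Leffler function
`E_{α,β}(z) = ∑_{k ≥ 0} z ^ k / Γ(α k + β)`, for a real or complex argument `z`.
(At a pole of `Γ` Mathlib's value `Γ = 0` makes the term vanish, which is the usual
convention `1 / Γ = 0`.) -/
noncomputable def mittagLeffler {𝕜 : Type*} [RCLike 𝕜] (α β : ℝ) (z : 𝕜) : 𝕜 :=
  ∑' k : ℕ, z ^ k / ((Real.Gamma (α * (k : ℝ) + β) : ℝ) : 𝕜)

/-- For real arguments, the real and the complex Mittag-Leffler functions agree. -/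
theorem ofReal_mittagLeffler (α β x : ℝ) :
    ((mittagLeffler α β x : ℝ) : ℂ) = mittagLeffler α β (x : ℂ) := by
  simp [mittagLeffler, Complex.ofReal_tsum]

/-- `d_α(t) = E_{α,1}(-lam t ^ α) - exp(-lam t)`. -/
noncomputable def mlDiff (α lam t : ℝ) : ℝ :=
  mittagLeffler α 1 (-lam * t ^ α) - Real.exp (-lam * t)

/-! Write `u(t) = E_{α,1}(-λ t^α)`. It solves the Volterra equation `u = 1 - λ I^α u`, while `exp(-λ
t)` solves the same equation with `I^1`. Inserting `u` into the second equation leaves the defect `D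
= u - 1 + λ I u`, which is minus the convolution of `k = t^(α-1)/Γ(α) - 1` with `λ u`. The kernel
`k` is `1 - α` times something bounded in `L^p(0, T)` uniformly in `α`, because `p (1 - α₀) < 1`.
The point is uniformity in `λ`: since `0 ≤ u ≤ 1`, the weight `λ u` is at most `λ`, and its mass on
`(0, T)` is bounded independently of `λ` (`mul_integral_mittagLeffler_le`). Young's inequality gives
the `L^p` bound for `D`, and Hölder's inequality with respect to the weight gives the sup bound with
the factor `λ^(1/p)`. Duhamel's formula `d = D - λ exp(-λ ·) * D` (`mlDiff_eq_mlDefect_sub`) passes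
both to `d`, as the exponential weight has mass at most one. -/

/-! ### Convergence and regularity of the Mittag-Leffler series -/

/-- Truncate the Gamma integral to `t > M`. With `M` free, this shows that `Γ` outgrows every
geometric sequence. -/
theorem Real.rpow_mul_exp_neg_le_Gamma {M x : ℝ} (hM : 0 < M) (hx : 0 ≤ x) :
    M ^ x * Real.exp (-M) ≤ Real.Gamma (x + 1) := by
  have hint := Real.GammaIntegral_convergent (s := x + 1) (by linarith)
  rw [Real.Gamma_eq_integral (by linarith)]
  calc M ^ x * Real.exp (-M) = ∫ t in Ioi M, M ^ x * Real.exp (-t) := by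
        rw [integral_const_mul, integral_exp_neg_Ioi]
    _ ≤ ∫ t in Ioi M, Real.exp (-t) * t ^ (x + 1 - 1) := by
        refine setIntegral_mono_on ((integrableOn_exp_neg_Ioi M).const_mul _)
          (hint.mono_set (Ioi_subset_Ioi hM.le)) measurableSet_Ioi fun t ht => ?_
        rw [mul_comm, add_sub_cancel_right]
        have : M < t := ht
        gcongr
    _ ≤ ∫ t in Ioi 0, Real.exp (-t) * t ^ (x + 1 - 1) := by
        refine setIntegral_mono_set hint ?_ (Ioi_subset_Ioi hM.le).eventuallyLE
        filter_upwards [ae_restrict_mem measurableSet_Ioi] with t ht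
        have : 0 < t := ht
        positivity

theorem summable_pow_div_Gamma {α b R : ℝ} (hα : 0 < α) (hb : 0 ≤ b) (hR : 0 ≤ R) :
    Summable fun k : ℕ => R ^ k / Real.Gamma (α * k + b + 1) := by
  -- Chosen so that `M ^ α = 2R + 1`, which makes the comparison series geometric with ratio `R /
  -- (2R + 1) < 1`.
  set M : ℝ := (2 * R + 1) ^ (1 / α) with hMdef
  have hM : 0 < M := by positivity
  have hMα : M ^ α = 2 * R + 1 := by
    rw [hMdef, ← Real.rpow_mul (by positivity), one_div_mul_cancel hα.ne', Real.rpow_one]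
  have hq : R / (2 * R + 1) < 1 := by rw [div_lt_one (by positivity)]; linarith
  refine Summable.of_nonneg_of_le (fun k => ?_) (fun k => ?_)
    ((summable_geometric_of_lt_one (by positivity) hq).mul_left (M ^ (-b) * Real.exp M))
  · exact div_nonneg (by positivity) (Real.Gamma_pos_of_pos (by positivity)).le
  · have h := Real.rpow_mul_exp_neg_le_Gamma (x := α * k + b) hM (by positivity)
    refine (div_le_div_of_nonneg_left (by positivity) (by positivity) h).trans (le_of_eq ?_)
    rw [Real.rpow_add hM, Real.rpow_mul hM.le, hMα, Real.rpow_natCast, Real.rpow_neg hM.le,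
      Real.exp_neg, div_pow]
    field_simp

theorem differentiable_mittagLeffler_one {α : ℝ} (hα : 0 < α) :
    Differentiable ℝ (mittagLeffler (𝕜 := ℝ) α 1) := by
  set c : ℕ → ℝ := fun k => 1 / Real.Gamma (α * k + 1) with hc
  have hrad : (FormalMultilinearSeries.ofScalars ℝ c).radius = ⊤ := by
    refine FormalMultilinearSeries.radius_eq_top_of_summable_norm _ fun r => ?_
    have := summable_pow_div_Gamma (b := 0) hα le_rfl r.coe_nonneg
    refine this.congr fun k => ?_
    rw [FormalMultilinearSeries.ofScalars_norm, hc, Real.norm_of_nonneg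
      (one_div_nonneg.2 (Real.Gamma_pos_of_pos (by positivity)).le), add_zero]
    ring
  have hsum : mittagLeffler (𝕜 := ℝ) α 1 = (FormalMultilinearSeries.ofScalars ℝ c).sum := by
    ext z
    rw [mittagLeffler]
    refine Eq.trans ?_ (FormalMultilinearSeries.ofScalars_sum_eq c z).symm
    refine tsum_congr fun k => ?_
    simp [hc]
    ring
  have hball := (FormalMultilinearSeries.ofScalars ℝ c).hasFPowerSeriesOnBall
    (by rw [hrad]; simp)
  rw [hrad] at hball
  rw [hsum]
  intro z
  exact (hball.analyticAt_of_mem (by simp)).differentiableAt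

theorem mittagLeffler_zero (α : ℝ) : mittagLeffler α 1 (0 : ℝ) = 1 := by
  rw [mittagLeffler, tsum_eq_single 0]
  · simp
  · intro k hk
    simp [hk]

theorem continuous_mittagLeffler_rpow {α : ℝ} (hα : 0 < α) (c : ℝ) :
    Continuous fun t : ℝ => mittagLeffler α 1 (c * t ^ α) :=
  (differentiable_mittagLeffler_one hα).continuous.comp
    (continuous_const.mul (Real.continuous_rpow_const hα.le))

theorem differentiableAt_mittagLeffler_rpow {α : ℝ} (hα : 0 < α) (c : ℝ) {t : ℝ} (ht : t ≠ 0) :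
    DifferentiableAt ℝ (fun t : ℝ => mittagLeffler α 1 (c * t ^ α)) t :=
  DifferentiableAt.comp t (g := mittagLeffler (𝕜 := ℝ) α 1)
    (differentiable_mittagLeffler_one hα _)
    ((Real.differentiableAt_rpow_const_of_ne α ht).const_mul c)

/-! ### Fractional integrals and the Volterra equation -/

theorem intervalIntegrable_sub_rpow {b : ℝ} (hb : 0 < b) (t x y : ℝ) :
    IntervalIntegrable (fun s : ℝ => (t - s) ^ (b - 1)) volume x y := by
  have := (intervalIntegral.intervalIntegrable_rpow' (r := b - 1) (a := t - x) (b := t - y)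
    (by linarith)).comp_sub_left (c := t)
  simpa using this

/-- The scaled Beta integral, transferred from the complex version. -/
theorem integral_sub_rpow_mul_rpow {a b t : ℝ} (ha : 0 ≤ a) (hb : 0 < b) (ht : 0 < t) :
    ∫ s in 0..t, (t - s) ^ (b - 1) * s ^ a =
      Real.Gamma b * Real.Gamma (a + 1) / Real.Gamma (a + b + 1) * t ^ (a + b) := by
  have h := Complex.betaIntegral_scaled ((a + 1 : ℝ) : ℂ) (b : ℂ) ht
  have hG := Complex.Gamma_mul_Gamma_eq_betaIntegral (s := ((a + 1 : ℝ) : ℂ)) (t := (b : ℂ))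
    (by simpa using by linarith) (by simpa using hb)
  have hpos : 0 < Real.Gamma (a + b + 1) := Real.Gamma_pos_of_pos (by linarith)
  rw [Complex.Gamma_ofReal, Complex.Gamma_ofReal, ← Complex.ofReal_add, Complex.Gamma_ofReal,
    show a + 1 + b = a + b + 1 by ring] at hG
  have hint : ∫ x in 0..t, (x : ℂ) ^ (((a + 1 : ℝ) : ℂ) - 1) * ((t : ℂ) - x) ^ ((b : ℂ) - 1) =
      ((∫ s in 0..t, (t - s) ^ (b - 1) * s ^ a : ℝ) : ℂ) := by
    rw [← intervalIntegral.integral_ofReal]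
    refine intervalIntegral.integral_congr fun x hx => ?_
    rw [uIcc_of_le ht.le] at hx
    simp only [Complex.ofReal_mul]
    rw [Complex.ofReal_cpow (sub_nonneg.2 hx.2), Complex.ofReal_cpow hx.1]
    push_cast
    ring_nf
  rw [hint] at h
  have ht' : (t : ℂ) ^ (((a + 1 : ℝ) : ℂ) + (b : ℂ) - 1) = ((t ^ (a + b) : ℝ) : ℂ) := by
    rw [Complex.ofReal_cpow ht.le]
    push_cast
    ring_nf
  rw [ht'] at h
  have hne : ((Real.Gamma (a + b + 1) : ℝ) : ℂ) ≠ 0 := by exact_mod_cast hpos.ne'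
  have : ((∫ s in 0..t, (t - s) ^ (b - 1) * s ^ a : ℝ) : ℂ) =
      ((Real.Gamma b * Real.Gamma (a + 1) / Real.Gamma (a + b + 1) * t ^ (a + b) : ℝ) : ℂ) := by
    rw [h]
    simp only [Complex.ofReal_mul, Complex.ofReal_div]
    field_simp
    linear_combination (-(t ^ (a + b) : ℝ) : ℂ) * hG
  exact_mod_cast this

/-- The fractional integral of order `b` of `t ↦ E_{α,1}(c t ^ α)`, as a series. -/
noncomputable def mlFrac (α c b t : ℝ) : ℝ :=
  ∑' k : ℕ, c ^ k * t ^ (α * k + b) / Real.Gamma (α * k + b + 1)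

theorem summable_mlFrac {α b t : ℝ} (c : ℝ) (hα : 0 < α) (hb : 0 ≤ b) (ht : 0 < t) :
    Summable fun k : ℕ => c ^ k * t ^ (α * k + b) / Real.Gamma (α * k + b + 1) := by
  have h := (summable_pow_div_Gamma (R := |c| * t ^ α) hα hb (by positivity)).mul_left (t ^ b)
  refine Summable.of_norm_bounded h fun k => le_of_eq ?_
  have : 0 < Real.Gamma (α * k + b + 1) := Real.Gamma_pos_of_pos (by positivity)
  rw [norm_div, norm_mul, norm_pow, Real.norm_of_nonneg this.le,
    Real.norm_of_nonneg (by positivity : 0 ≤ t ^ (α * k + b)), Real.rpow_add ht,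
    Real.rpow_mul ht.le, Real.rpow_natCast, Real.norm_eq_abs]
  ring

/-- Splitting off the term `k = 0` shifts the order from `b` to `b + α`; every integral equation
below comes from this recursion. -/
theorem mlFrac_eq_add_mul {α b t : ℝ} (c : ℝ) (hα : 0 < α) (hb : 0 ≤ b) (ht : 0 < t) :
    mlFrac α c b t = t ^ b / Real.Gamma (b + 1) + c * mlFrac α c (b + α) t := by
  rw [mlFrac, (summable_mlFrac c hα hb ht).tsum_eq_zero_add, mlFrac, ← tsum_mul_left]
  congr 1
  · simp
  · refine tsum_congr fun k => ?_
    push_cast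
    rw [show α * ((k : ℝ) + 1) + b = α * k + (b + α) by ring]
    ring

theorem mittagLeffler_rpow_eq_mlFrac {α t : ℝ} (c : ℝ) (ht : 0 < t) :
    mittagLeffler α 1 (c * t ^ α) = mlFrac α c 0 t := by
  rw [mittagLeffler, mlFrac]
  refine tsum_congr fun k => ?_
  rw [add_zero, Real.rpow_mul ht.le, Real.rpow_natCast, mul_pow]
  rfl

/-- Termwise integration. The integrals of the norms form the same series with `|c|` for `c`, which
converges. -/
theorem integral_sub_rpow_mul_mittagLeffler {α b t : ℝ} (c : ℝ) (hα : 0 < α) (hb : 0 < b)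
    (ht : 0 < t) :
    ∫ s in 0..t, (t - s) ^ (b - 1) * mittagLeffler α 1 (c * s ^ α) =
      Real.Gamma b * mlFrac α c b t := by
  have hterm : ∀ (c : ℝ) (k : ℕ), ∫ s in Ioc 0 t,
      c ^ k / Real.Gamma (α * k + 1) * ((t - s) ^ (b - 1) * s ^ (α * k)) =
      Real.Gamma b * (c ^ k * t ^ (α * k + b) / Real.Gamma (α * k + b + 1)) := by
    intro c k
    have hG : 0 < Real.Gamma (α * k + 1) := Real.Gamma_pos_of_pos (by positivity)
    rw [integral_const_mul, ← intervalIntegral.integral_of_le ht.le,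
      integral_sub_rpow_mul_rpow (by positivity) hb ht]
    field_simp
  have hint : ∀ k : ℕ, Integrable
      (fun s => c ^ k / Real.Gamma (α * k + 1) * ((t - s) ^ (b - 1) * s ^ (α * k)))
      (volume.restrict (Ioc 0 t)) := by
    intro k
    refine Integrable.const_mul ?_ _
    exact ((intervalIntegrable_iff_integrableOn_Ioc_of_le ht.le).1
      ((intervalIntegrable_sub_rpow hb t 0 t).mul_continuousOn
        (Real.continuous_rpow_const (by positivity : 0 ≤ α * (k : ℝ))).continuousOn))
  have hnorm : ∀ k : ℕ, ∫ s in Ioc 0 t,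
      ‖c ^ k / Real.Gamma (α * k + 1) * ((t - s) ^ (b - 1) * s ^ (α * k))‖ =
      Real.Gamma b * (|c| ^ k * t ^ (α * k + b) / Real.Gamma (α * k + b + 1)) := by
    intro k
    rw [← hterm |c| k]
    refine setIntegral_congr_fun measurableSet_Ioc fun s hs => ?_
    have hG : 0 < Real.Gamma (α * k + 1) := Real.Gamma_pos_of_pos (by positivity)
    have h1 : 0 ≤ (t - s) ^ (b - 1) := Real.rpow_nonneg (sub_nonneg.2 hs.2) _
    have h2 : 0 ≤ s ^ (α * k) := Real.rpow_nonneg hs.1.le _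
    simp only [norm_mul, norm_div, norm_pow, Real.norm_eq_abs, abs_of_pos hG, abs_of_nonneg h1,
      abs_of_nonneg h2]
  have hsum := hasSum_integral_of_summable_integral_norm hint (by
    simp_rw [hnorm]
    exact (summable_mlFrac |c| hα hb.le ht).mul_left _)
  simp_rw [hterm] at hsum
  rw [mlFrac, ← tsum_mul_left, hsum.tsum_eq, intervalIntegral.integral_of_le ht.le]
  refine setIntegral_congr_fun measurableSet_Ioc fun s hs => ?_
  have hs0 : 0 < s := hs.1
  simp only [mittagLeffler]
  rw [← tsum_mul_left]
  refine tsum_congr fun k => ?_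
  rw [Real.rpow_mul hs0.le, Real.rpow_natCast, mul_pow]
  simp only [RCLike.ofReal_real_eq_id, id_eq]
  ring

/-- The Volterra equation `u = 1 + c I^α u`. -/
theorem mittagLeffler_eq_one_add_integral {α t : ℝ} (c : ℝ) (hα : 0 < α) (ht : 0 < t) :
    mittagLeffler α 1 (c * t ^ α) = 1 + c / Real.Gamma α *
      ∫ s in 0..t, (t - s) ^ (α - 1) * mittagLeffler α 1 (c * s ^ α) := by
  have hG : 0 < Real.Gamma α := Real.Gamma_pos_of_pos hα
  rw [integral_sub_rpow_mul_mittagLeffler c hα hα ht, mittagLeffler_rpow_eq_mlFrac c ht,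
    mlFrac_eq_add_mul c hα le_rfl ht]
  simp
  field_simp

/-- The equation `I^{1-α} (u - 1) = c I u`. -/
theorem integral_sub_rpow_neg_mul_mittagLeffler {α t : ℝ} (c : ℝ) (hα : 0 < α) (hα1 : α < 1)
    (ht : 0 < t) :
    ∫ s in 0..t, (t - s) ^ (-α) * (mittagLeffler α 1 (c * s ^ α) - 1) =
      c * Real.Gamma (1 - α) * ∫ s in 0..t, mittagLeffler α 1 (c * s ^ α) := by
  have h1 := integral_sub_rpow_mul_mittagLeffler c hα (b := 1 - α) (by linarith) ht
  have h2 := integral_sub_rpow_mul_mittagLeffler c hα (b := 1) one_pos ht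
  have h3 := mlFrac_eq_add_mul c hα (b := 1 - α) (by linarith) ht
  have h4 := integral_sub_rpow_mul_rpow (a := 0) (b := 1 - α) le_rfl (by linarith) ht
  have hi := intervalIntegrable_sub_rpow (b := 1 - α) (by linarith) t 0 t
  rw [show (1 : ℝ) - α - 1 = -α by ring] at h1 h4 hi
  simp only [sub_self, Real.rpow_zero, one_mul, Real.Gamma_one, mul_one, zero_add] at h2 h4
  rw [show (1 : ℝ) - α + α = 1 by ring] at h3
  simp_rw [mul_sub, mul_one]
  rw [intervalIntegral.integral_sub
    (hi.mul_continuousOn (continuous_mittagLeffler_rpow hα c).continuousOn) hi, h1, h2, h4, h3]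
  ring

/-! ### Positivity, upper bound and mass of `u` -/

/-- A minimum principle for the fractional derivative. At a negative minimum `m = u(t₁)`, the
integral `J(t) = ∫₀ᵗ (t - s)^(-α) (u(s) - m) ds` would have to grow at least linearly in `h` from
`t₁ - h` to `t₁`, by the equation for `u`; but minimality and differentiability at `t₁` allow a
growth of only `O(h^(2-α))`. -/
theorem mittagLeffler_neg_mul_rpow_nonneg {α lam t : ℝ} (hα : 0 < α) (hα1 : α < 1)
    (hlam : 0 < lam) (ht : 0 ≤ t) : 0 ≤ mittagLeffler α 1 (-lam * t ^ α) := by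
  by_contra! hneg
  set u : ℝ → ℝ := fun t => mittagLeffler α 1 (-lam * t ^ α) with hu
  have hcont : Continuous u := continuous_mittagLeffler_rpow hα (-lam)
  obtain ⟨t₁, ht₁, hmin⟩ :=
    isCompact_Icc.exists_isMinOn (nonempty_Icc.2 ht) hcont.continuousOn
  set m := u t₁ with hm
  have hm0 : m < 0 := (hmin (right_mem_Icc.2 ht)).trans_lt hneg
  have hu0 : u 0 = 1 := by simp [hu, Real.zero_rpow hα.ne', mittagLeffler_zero]
  have ht₁0 : 0 < t₁ := by
    refine lt_of_le_of_ne ht₁.1 fun h => ?_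
    rw [hm, ← h, hu0] at hm0
    linarith
  have hw : ∀ s ∈ Icc 0 t₁, 0 ≤ u s - m := fun s hs =>
    sub_nonneg.2 (hmin ⟨hs.1, hs.2.trans ht₁.2⟩)
  have hG : 0 < Real.Gamma (1 - α) := Real.Gamma_pos_of_pos (by linarith)
  obtain ⟨M, hM⟩ :=
    (differentiableAt_mittagLeffler_rpow hα (-lam) ht₁0.ne').hasDerivAt.isBigO_sub.bound
  have hupper : ∀ᶠ s in nhds t₁, u s < m / 2 :=
    hcont.continuousAt.eventually_lt continuousAt_const (by rw [← hm]; linarith)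
  obtain ⟨δ, hδ, hball⟩ := Metric.eventually_nhds_iff.1 (hM.and hupper)
  have hsmall : ∀ᶠ h in nhdsWithin (0 : ℝ) (Ioi 0),
      |M| * h ^ (1 - α) / (1 - α) < lam * Real.Gamma (1 - α) * (-m / 2) := by
    have hc : Continuous fun h : ℝ => |M| * h ^ (1 - α) / (1 - α) :=
      (continuous_const.mul (Real.continuous_rpow_const (by linarith))).div_const _
    refine (hc.continuousAt.eventually_lt continuousAt_const ?_).filter_mono nhdsWithin_le_nhds
    rw [Real.zero_rpow (by linarith)]
    have := mul_pos (mul_pos hlam hG) (by linarith : 0 < -m / 2)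
    simpa using this
  obtain ⟨h, hh, hhpos, hhlt⟩ :=
    (hsmall.and (Ioo_mem_nhdsGT (lt_min hδ ht₁0))).exists
  have hhδ : h < δ := hhlt.trans_le (min_le_left _ _)
  have hht : h < t₁ := hhlt.trans_le (min_le_right _ _)
  have hker : ∀ t x y : ℝ, IntervalIntegrable (fun s => (t - s) ^ (-α)) volume x y := by
    intro t x y
    have := intervalIntegrable_sub_rpow (b := 1 - α) (by linarith) t x y
    rwa [show (1 : ℝ) - α - 1 = -α by ring] at this
  have hkerw : ∀ t x y : ℝ,
      IntervalIntegrable (fun s => (t - s) ^ (-α) * (u s - m)) volume x y := fun t x y =>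
    (hker t x y).mul_continuousOn (hcont.sub continuous_const).continuousOn
  have hJ : ∀ t, 0 < t → ∫ s in 0..t, (t - s) ^ (-α) * (u s - m) =
      -lam * Real.Gamma (1 - α) * (∫ s in 0..t, u s) + (1 - m) * (t ^ (1 - α) / (1 - α)) := by
    intro t ht
    have h1 := integral_sub_rpow_neg_mul_mittagLeffler (-lam) hα hα1 ht
    have h2 : ∫ s in 0..t, (t - s) ^ (-α) = t ^ (1 - α) / (1 - α) := by
      rw [intervalIntegral.integral_comp_sub_left (fun s => s ^ (-α)) t,
        integral_rpow (Or.inl (by linarith))]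
      rw [sub_self, sub_zero, Real.zero_rpow (by linarith), neg_add_eq_sub, sub_zero]
    rw [← h1, ← h2, ← intervalIntegral.integral_const_mul, ← intervalIntegral.integral_add]
    · refine intervalIntegral.integral_congr fun s _ => ?_
      simp only [hu]
      ring
    · exact (hker t 0 t).mul_continuousOn (hcont.sub continuous_const).continuousOn
    · exact (hker t 0 t).const_mul _
  have hJ₁ := hJ t₁ ht₁0
  have hJ₂ := hJ (t₁ - h) (by linarith)
  have hsplit := intervalIntegral.integral_add_adjacent_intervals
    (hkerw t₁ 0 (t₁ - h)) (hkerw t₁ (t₁ - h) t₁)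
  have husplit := intervalIntegral.integral_add_adjacent_intervals
    (hcont.intervalIntegrable (μ := volume) 0 (t₁ - h)) (hcont.intervalIntegrable (t₁ - h) t₁)
  -- The kernel decreases when `t₁ - h` is replaced by `t₁`, and `u - m ≥ 0`: the old part of the
  -- integral can only shrink.
  have hfirst : ∫ s in 0..(t₁ - h), (t₁ - s) ^ (-α) * (u s - m) ≤
      ∫ s in 0..(t₁ - h), (t₁ - h - s) ^ (-α) * (u s - m) := by
    refine intervalIntegral.integral_mono_on_of_le_Ioo (by linarith) (hkerw _ _ _) (hkerw _ _ _)
      fun s hs => ?_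
    refine mul_le_mul_of_nonneg_right ?_ (hw s ⟨hs.1.le, by linarith [hs.2]⟩)
    exact Real.rpow_le_rpow_of_nonpos (by linarith [hs.2]) (by linarith) (by linarith)
  have hsecond : ∫ s in (t₁ - h)..t₁, (t₁ - s) ^ (-α) * (u s - m) ≤
      |M| * h * (h ^ (1 - α) / (1 - α)) := by
    have h2 : ∫ s in (t₁ - h)..t₁, (t₁ - s) ^ (-α) = h ^ (1 - α) / (1 - α) := by
      rw [intervalIntegral.integral_comp_sub_left (fun s => s ^ (-α)) t₁,
        integral_rpow (Or.inl (by linarith))]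
      rw [sub_self, sub_sub_cancel, Real.zero_rpow (by linarith), neg_add_eq_sub, sub_zero]
    rw [← h2, ← intervalIntegral.integral_const_mul]
    refine intervalIntegral.integral_mono_on_of_le_Ioo (by linarith) (hkerw _ _ _)
      ((hker _ _ _).const_mul _) fun s hs => ?_
    have hd : dist s t₁ < δ := by
      rw [Real.dist_eq, abs_lt]
      constructor <;> linarith [hs.1, hs.2]
    have h3 := (hball hd).1
    rw [Real.norm_eq_abs, Real.norm_eq_abs] at h3
    have h4 : u s - m ≤ |M| * h := by
      refine (le_abs_self _).trans (h3.trans ?_)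
      refine mul_le_mul (le_abs_self M) ?_ (abs_nonneg _) (abs_nonneg _)
      rw [abs_le]
      constructor <;> linarith [hs.1, hs.2]
    rw [mul_comm]
    exact mul_le_mul_of_nonneg_right h4 (Real.rpow_nonneg (by linarith [hs.2]) _)
  have hu_int : ∫ s in (t₁ - h)..t₁, u s ≤ h * (m / 2) := by
    have : ∫ s in (t₁ - h)..t₁, u s ≤ ∫ _ in (t₁ - h)..t₁, m / 2 := by
      refine intervalIntegral.integral_mono_on_of_le_Ioo (by linarith)
        (hcont.intervalIntegrable _ _) intervalIntegrable_const fun s hs => ?_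
      refine (hball ?_).2.le
      rw [Real.dist_eq, abs_lt]
      constructor <;> linarith [hs.1, hs.2]
    rwa [intervalIntegral.integral_const, sub_sub_cancel, smul_eq_mul] at this
  have hpow : (t₁ - h) ^ (1 - α) / (1 - α) ≤ t₁ ^ (1 - α) / (1 - α) := by
    have : 0 < 1 - α := by linarith
    have : 0 ≤ t₁ - h := by linarith
    gcongr
    linarith
  have hlG := mul_pos hlam hG
  -- Subtract the two instances of `hJ`. The left side bounds the increment of `J` from below, the
  -- right side from above.
  have key : lam * Real.Gamma (1 - α) * (h * (-m / 2)) ≤ |M| * h * (h ^ (1 - α) / (1 - α)) := by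
    have e1 := mul_le_mul_of_nonneg_left hu_int hlG.le
    have e2 := mul_le_mul_of_nonneg_left hpow (by linarith : 0 ≤ 1 - m)
    rw [← husplit] at hJ₁
    nlinarith
  have := mul_lt_mul_of_pos_left hh hhpos
  rw [mul_div_assoc] at this
  linarith

theorem mittagLeffler_neg_mul_rpow_le_one {α lam t : ℝ} (hα : 0 < α) (hα1 : α < 1)
    (hlam : 0 < lam) (ht : 0 < t) : mittagLeffler α 1 (-lam * t ^ α) ≤ 1 := by
  rw [mittagLeffler_eq_one_add_integral _ hα ht]
  have hG : 0 < Real.Gamma α := Real.Gamma_pos_of_pos hα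
  have : 0 ≤ ∫ s in 0..t, (t - s) ^ (α - 1) * mittagLeffler α 1 (-lam * s ^ α) :=
    intervalIntegral.integral_nonneg ht.le fun s hs =>
      mul_nonneg (Real.rpow_nonneg (sub_nonneg.2 hs.2) _)
        (mittagLeffler_neg_mul_rpow_nonneg hα hα1 hlam hs.1)
  have := mul_nonneg (div_pos hlam hG).le this
  rw [neg_div]
  linarith

/-- On `(0, t)` the kernel `(t - s)^(α-1)` is at least `t^(α-1)`, and `λ I^α u = 1 - u ≤ 1` by
positivity. The bound is free of `λ`. -/
theorem mul_integral_mittagLeffler_le {α lam t : ℝ} (hα : 0 < α) (hα1 : α < 1)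
    (hlam : 0 < lam) (ht : 0 < t) :
    lam * ∫ s in 0..t, mittagLeffler α 1 (-lam * s ^ α) ≤ Real.Gamma α * t ^ (1 - α) := by
  have hG : 0 < Real.Gamma α := Real.Gamma_pos_of_pos hα
  have hcont := continuous_mittagLeffler_rpow hα (-lam)
  have h1 := mittagLeffler_eq_one_add_integral (-lam) hα ht
  have h0 := mittagLeffler_neg_mul_rpow_nonneg hα hα1 hlam ht.le
  have h2 : t ^ (α - 1) * ∫ s in 0..t, mittagLeffler α 1 (-lam * s ^ α) ≤
      ∫ s in 0..t, (t - s) ^ (α - 1) * mittagLeffler α 1 (-lam * s ^ α) := by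
    rw [← intervalIntegral.integral_const_mul]
    refine intervalIntegral.integral_mono_on_of_le_Ioo ht.le
      ((hcont.intervalIntegrable _ _).const_mul _)
      ((intervalIntegrable_sub_rpow hα t 0 t).mul_continuousOn hcont.continuousOn) fun s hs => ?_
    refine mul_le_mul_of_nonneg_right ?_
      (mittagLeffler_neg_mul_rpow_nonneg hα hα1 hlam hs.1.le)
    exact Real.rpow_le_rpow_of_nonpos (by linarith [hs.2]) (by linarith [hs.1]) (by linarith)
  have h3 : lam / Real.Gamma α *
      ∫ s in 0..t, (t - s) ^ (α - 1) * mittagLeffler α 1 (-lam * s ^ α) ≤ 1 := by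
    rw [h1, neg_div] at h0
    linarith
  have h4 := (mul_le_mul_of_nonneg_left h2 (div_pos hlam hG).le).trans h3
  have h5 : t ^ (1 - α) * t ^ (α - 1) = 1 := by
    rw [← Real.rpow_add ht]
    simp
  have h6 := mul_le_mul_of_nonneg_left h4 (by positivity : 0 ≤ Real.Gamma α * t ^ (1 - α))
  calc lam * ∫ s in 0..t, mittagLeffler α 1 (-lam * s ^ α)
      = (t ^ (1 - α) * t ^ (α - 1)) * (lam * ∫ s in 0..t, mittagLeffler α 1 (-lam * s ^ α)) := by
        rw [h5, one_mul]
    _ = Real.Gamma α * t ^ (1 - α) * (lam / Real.Gamma α *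
        (t ^ (α - 1) * ∫ s in 0..t, mittagLeffler α 1 (-lam * s ^ α))) := by
        field_simp
    _ ≤ Real.Gamma α * t ^ (1 - α) := by simpa using h6

/-! ### Distance of the kernel from 1 -/

/-- Bernoulli's inequality for `x^ε = (x^ε₀)^(ε/ε₀)`; it extracts a factor linear in `ε`. -/
theorem Real.rpow_sub_one_le_div_mul {x ε ε₀ : ℝ} (hx : 0 < x) (hε : 0 ≤ ε) (hε₀ : 0 < ε₀)
    (h : ε ≤ ε₀) : x ^ ε - 1 ≤ ε / ε₀ * (x ^ ε₀ - 1) := by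
  have hy : 0 ≤ x ^ ε₀ := by positivity
  have := rpow_one_add_le_one_add_mul_self (s := x ^ ε₀ - 1) (by linarith)
    (p := ε / ε₀) (by positivity) ((div_le_one hε₀).2 h)
  rw [add_sub_cancel, ← Real.rpow_mul hx.le, mul_div_cancel₀ _ hε₀.ne'] at this
  linarith

theorem abs_rpow_neg_sub_one_le {t ε ε₀ : ℝ} (ht : 0 < t) (hε : 0 ≤ ε) (hε₀ : 0 < ε₀)
    (h : ε ≤ ε₀) : |t ^ (-ε) - 1| ≤ ε / ε₀ * (t ^ (-ε₀) + t ^ ε₀) := by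
  have h1 := Real.rpow_sub_one_le_div_mul (inv_pos.2 ht) hε hε₀ h
  have h2 := Real.rpow_sub_one_le_div_mul ht hε hε₀ h
  rw [Real.inv_rpow ht.le, Real.inv_rpow ht.le, ← Real.rpow_neg ht.le, ← Real.rpow_neg ht.le] at h1
  have hq : 0 ≤ ε / ε₀ := by positivity
  have p1 := mul_nonneg hq (by positivity : 0 ≤ t ^ (-ε₀))
  have p2 := mul_nonneg hq (by positivity : 0 ≤ t ^ ε₀)
  have hpos : 0 < t ^ ε := by positivity
  -- This is `y + 1/y ≥ 2` with `y = t ^ ε`.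
  have h3 : 1 - t ^ (-ε) ≤ t ^ ε - 1 := by
    have : t ^ ε * t ^ (-ε) = 1 := by rw [← Real.rpow_add ht]; simp
    nlinarith [sq_nonneg (t ^ ε - 1)]
  rw [abs_le]
  constructor <;> nlinarith

theorem Real.one_le_Gamma_of_le_one {x : ℝ} (hx : 0 < x) (hx1 : x ≤ 1) : 1 ≤ Real.Gamma x := by
  rw [← Real.Gamma_one]
  exact Real.Gamma_strictAntiOn_Ioc.antitoneOn ⟨hx, hx1⟩ ⟨one_pos, le_rfl⟩ hx1

/-- By convexity, `Γ` lies below its chord from `α₀` to `1`. -/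
theorem Real.Gamma_sub_one_le {α₀ α : ℝ} (hα₀ : 0 < α₀) (hα₀1 : α₀ < 1) (h : α₀ ≤ α) (h1 : α ≤ 1) :
    Real.Gamma α - 1 ≤ (1 - α) / (1 - α₀) * Real.Gamma α₀ := by
  have hε : 0 < 1 - α₀ := by linarith
  set θ := (1 - α) / (1 - α₀) with hθ
  have hθ0 : 0 ≤ θ := div_nonneg (by linarith) hε.le
  have hθ1 : θ ≤ 1 := (div_le_one hε).2 (by linarith)
  have := Real.convexOn_Gamma.2 (mem_Ioi.2 hα₀) (mem_Ioi.2 one_pos) hθ0 (sub_nonneg.2 hθ1)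
    (add_sub_cancel θ 1)
  have hθε : θ * (1 - α₀) = 1 - α := div_mul_cancel₀ _ hε.ne'
  simp only [smul_eq_mul, mul_one, Real.Gamma_one] at this
  rw [show θ * α₀ + (1 - θ) = α by linarith] at this
  linarith

theorem abs_rpow_div_Gamma_sub_one_le {α₀ α t : ℝ} (hα₀ : 0 < α₀) (hα₀1 : α₀ < 1) (h : α₀ ≤ α)
    (h1 : α ≤ 1) (ht : 0 < t) :
    |t ^ (α - 1) / Real.Gamma α - 1| ≤
      (1 - α) * ((t ^ (-(1 - α₀)) + t ^ (1 - α₀) + Real.Gamma α₀) / (1 - α₀)) := by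
  have hG := Real.one_le_Gamma_of_le_one (hα₀.trans_le h) h1
  have hG2 := Real.Gamma_sub_one_le hα₀ hα₀1 h h1
  have h3 := abs_rpow_neg_sub_one_le (ε := 1 - α) (ε₀ := 1 - α₀) ht (by linarith) (by linarith)
    (by linarith)
  rw [neg_sub 1 α] at h3
  have hG0 : 0 < Real.Gamma α := by linarith
  calc |t ^ (α - 1) / Real.Gamma α - 1| = |t ^ (α - 1) - Real.Gamma α| / Real.Gamma α := by
        rw [div_sub_one hG0.ne', abs_div, abs_of_pos hG0]
    _ ≤ |t ^ (α - 1) - Real.Gamma α| := div_le_self (abs_nonneg _) hG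
    _ ≤ |t ^ (α - 1) - 1| + |1 - Real.Gamma α| := abs_sub_le _ _ _
    _ ≤ _ := by
        rw [abs_of_nonpos (by linarith : 1 - Real.Gamma α ≤ 0)]
        refine (add_le_add h3 (by linarith : _ ≤ (1 - α) / (1 - α₀) * Real.Gamma α₀)).trans
          (le_of_eq ?_)
        ring

/-! ### Convolution inequalities -/

/-- Convolution on the line of functions with values in `[0, ∞]`. -/
noncomputable def lineConv (f w : ℝ → ℝ≥0∞) (t : ℝ) : ℝ≥0∞ := ∫⁻ s, f (t - s) * w s

theorem lineConv_eq_lintegral_sub (f w : ℝ → ℝ≥0∞) (t : ℝ) :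
    lineConv f w t = ∫⁻ s, f s * w (t - s) := by
  rw [lineConv, ← lintegral_sub_left_eq_self (fun s => f s * w (t - s)) t]
  simp

theorem measurable_lineConv {f w : ℝ → ℝ≥0∞} (hf : Measurable f) (hw : Measurable w) :
    Measurable (lineConv f w) := by
  unfold lineConv
  exact Measurable.lintegral_prod_right' (f := fun z : ℝ × ℝ => f (z.1 - z.2) * w z.2)
    (by fun_prop)

/-- Hölder's inequality for the measure `w dμ`, obtained by splitting `w = w^(1/p) w^(1/q)`. -/
theorem rpow_lintegral_mul_le {X : Type*} [MeasurableSpace X] {μ : Measure X} {p : ℝ} (hp : 1 ≤ p)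
    {f w : X → ℝ≥0∞} (hf : Measurable f) (hw : Measurable w) :
    (∫⁻ x, f x * w x ∂μ) ^ p ≤ (∫⁻ x, w x ∂μ) ^ (p - 1) * ∫⁻ x, f x ^ p * w x ∂μ := by
  rcases hp.eq_or_lt with rfl | hp
  · simp
  have hp0 : 0 < p := one_pos.trans hp
  have hpq := Real.HolderConjugate.conjExponent hp
  set q := p.conjExponent with hq
  have hq0 : 0 < q := hpq.symm.pos
  have h := ENNReal.lintegral_mul_le_Lp_mul_Lq μ hpq
    (f := fun x => f x * w x ^ (1 / p)) (g := fun x => w x ^ (1 / q))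
    (by fun_prop) (by fun_prop)
  have e1 : ∀ x, f x * w x ^ (1 / p) * w x ^ (1 / q) = f x * w x := fun x => by
    rw [mul_assoc, ← ENNReal.rpow_add_of_nonneg _ _ (by positivity) (by positivity)]
    have : 1 / p + 1 / q = 1 := by simpa using hpq.inv_add_inv_eq_one
    rw [this, ENNReal.rpow_one]
  have e2 : ∀ x, (f x * w x ^ (1 / p)) ^ p = f x ^ p * w x := fun x => by
    rw [ENNReal.mul_rpow_of_nonneg _ _ hp0.le, ← ENNReal.rpow_mul, one_div_mul_cancel hp0.ne',
      ENNReal.rpow_one]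
  have e3 : ∀ x, (w x ^ (1 / q)) ^ q = w x := fun x => by
    rw [← ENNReal.rpow_mul, one_div_mul_cancel hq0.ne', ENNReal.rpow_one]
  simp only [Pi.mul_apply, e1, e2, e3] at h
  refine (ENNReal.rpow_le_rpow h hp0.le).trans (le_of_eq ?_)
  rw [ENNReal.mul_rpow_of_nonneg _ _ hp0.le, ← ENNReal.rpow_mul, ← ENNReal.rpow_mul,
    one_div_mul_cancel hp0.ne', ENNReal.rpow_one, mul_comm]
  congr 2
  rw [hq, Real.conjExponent]
  have : p - 1 ≠ 0 := by linarith
  field_simp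

theorem rpow_lineConv_le {p : ℝ} (hp : 1 ≤ p) {f w : ℝ → ℝ≥0∞} (hf : Measurable f)
    (hw : Measurable w) (t : ℝ) :
    lineConv f w t ^ p ≤ (∫⁻ s, w s) ^ (p - 1) * lineConv (fun r => f r ^ p) w t :=
  rpow_lintegral_mul_le hp (f := fun s => f (t - s)) (by fun_prop) hw

theorem lintegral_lineConv {f w : ℝ → ℝ≥0∞} (hf : Measurable f) (hw : Measurable w) :
    ∫⁻ t, lineConv f w t = (∫⁻ s, w s) * ∫⁻ t, f t := by
  unfold lineConv
  rw [lintegral_lintegral_swap (by fun_prop), ← lintegral_mul_const _ hw]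
  refine lintegral_congr fun s => ?_
  rw [lintegral_mul_const _ (by fun_prop), lintegral_sub_right_eq_self f s, mul_comm]

theorem lineConv_le_mul_lintegral_right {f w : ℝ → ℝ≥0∞} (hw : Measurable w) {B : ℝ≥0∞}
    (hB : ∀ t, f t ≤ B) (t : ℝ) : lineConv f w t ≤ B * ∫⁻ s, w s := by
  rw [← lintegral_const_mul _ hw]
  exact lintegral_mono fun s => mul_le_mul_left (hB _) _

theorem lineConv_le_mul_lintegral_left {f w : ℝ → ℝ≥0∞} (hf : Measurable f) {B : ℝ≥0∞}
    (hB : ∀ t, w t ≤ B) (t : ℝ) : lineConv f w t ≤ B * ∫⁻ s, f s := by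
  rw [← lintegral_sub_left_eq_self f t, ← lintegral_const_mul _ (by fun_prop)]
  exact lintegral_mono fun s => (mul_comm _ _).trans_le (mul_le_mul_left (hB _) _)

/-- Young's inequality for the convolution of an `L^p` and an `L^1` function. -/
theorem lintegral_rpow_lineConv_le {p : ℝ} (hp : 1 ≤ p) {f w : ℝ → ℝ≥0∞} (hf : Measurable f)
    (hw : Measurable w) :
    ∫⁻ t, lineConv f w t ^ p ≤ (∫⁻ s, w s) ^ p * ∫⁻ t, f t ^ p := by
  refine (lintegral_mono fun t => rpow_lineConv_le hp hf hw t).trans (le_of_eq ?_)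
  rw [lintegral_const_mul _ (measurable_lineConv (by fun_prop) hw),
    lintegral_lineConv (by fun_prop) hw, ← mul_assoc]
  congr 1
  nth_rewrite 2 [← ENNReal.rpow_one (∫⁻ s, w s)]
  rw [← ENNReal.rpow_add_of_nonneg _ _ (by linarith) zero_le_one, sub_add_cancel]

/-! ### The defect, its kernel majorant and the two weights -/

theorem memLp_rpow_neg_Ioo {T ε p : ℝ} (hp : 1 ≤ p) (h : p * ε < 1) :
    MemLp (fun t : ℝ => t ^ (-ε)) (ENNReal.ofReal p) (volume.restrict (Ioo 0 T)) := by
  have hmeas : Measurable fun t : ℝ => t ^ (-ε) := by fun_prop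
  rw [← integrable_norm_rpow_iff hmeas.aestronglyMeasurable (by simp; linarith) (by simp),
    ENNReal.toReal_ofReal (by linarith)]
  have hint : IntegrableOn (fun t : ℝ => t ^ (-(p * ε))) (Ioo 0 T) volume := by
    rcases le_or_gt T 0 with hT | hT
    · simp [Ioo_eq_empty_of_le hT]
    · exact (intervalIntegral.integrableOn_Ioo_rpow_iff hT).2 (by linarith)
  refine hint.congr_fun (fun t ht => ?_) measurableSet_Ioo
  simp only
  rw [Real.norm_of_nonneg (Real.rpow_nonneg ht.1.le _), ← Real.rpow_mul ht.1.le]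
  ring_nf

/-- The defect `U' - 1 + lam U`, where `U` is the primitive of `t ↦ E_{α,1}(-lam t ^ α)`. -/
noncomputable def mlDefect (α lam t : ℝ) : ℝ :=
  mittagLeffler α 1 (-lam * t ^ α) - 1 + lam * ∫ s in 0..t, mittagLeffler α 1 (-lam * s ^ α)

theorem continuous_mlDefect {α : ℝ} (hα : 0 < α) (lam : ℝ) : Continuous (mlDefect α lam) := by
  have hc := continuous_mittagLeffler_rpow hα (-lam)
  exact (hc.sub continuous_const).add (continuous_const.mul
    (intervalIntegral.continuous_primitive (fun a b => hc.intervalIntegrable a b) 0))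

/-- Duhamel's formula: the integrand is the exact derivative of `exp(-λ (t - s)) (λ U(s) - 1)`. -/
theorem mlDiff_eq_mlDefect_sub {α : ℝ} (hα : 0 < α) (lam t : ℝ) :
    mlDiff α lam t = mlDefect α lam t -
      ∫ s in 0..t, lam * Real.exp (-lam * (t - s)) * mlDefect α lam s := by
  have hc := continuous_mittagLeffler_rpow hα (-lam)
  set U : ℝ → ℝ := fun t => ∫ s in 0..t, mittagLeffler α 1 (-lam * s ^ α) with hU
  have hUd : ∀ s, HasDerivAt U (mittagLeffler α 1 (-lam * s ^ α)) s := fun s =>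
    hc.deriv_integral _ 0 s ▸ (intervalIntegral.differentiable_integral_of_continuous hc s).hasDerivAt
  have hexp : ∀ s, HasDerivAt (fun s => Real.exp (-lam * (t - s)))
      (Real.exp (-lam * (t - s)) * lam) s := fun s => by
    have h : HasDerivAt (fun s => -lam * (t - s)) lam s := by
      simpa using ((hasDerivAt_id s).const_sub t).const_mul (-lam)
    exact h.exp
  have hd : ∀ s, HasDerivAt (fun s => Real.exp (-lam * (t - s)) * (lam * U s - 1))
      (lam * Real.exp (-lam * (t - s)) * mlDefect α lam s) s := fun s => by
    refine ((hexp s).mul (((hUd s).const_mul lam).sub_const 1)).congr_deriv ?_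
    simp only [mlDefect, hU]
    ring
  have hcont : Continuous fun s => lam * Real.exp (-lam * (t - s)) * mlDefect α lam s :=
    (by fun_prop : Continuous fun s => lam * Real.exp (-lam * (t - s))).mul
      (continuous_mlDefect hα lam)
  rw [intervalIntegral.integral_eq_sub_of_hasDerivAt (fun s _ => hd s)
    (hcont.intervalIntegrable _ _)]
  simp only [mlDiff, mlDefect, hU, sub_self, mul_zero, Real.exp_zero,
    intervalIntegral.integral_same, sub_zero]
  ring

theorem mlDefect_eq_integral {α lam t : ℝ} (hα : 0 < α) (ht : 0 < t) :
    mlDefect α lam t = -∫ s in 0..t, ((t - s) ^ (α - 1) / Real.Gamma α - 1) *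
      (lam * mittagLeffler α 1 (-lam * s ^ α)) := by
  have hc := continuous_mittagLeffler_rpow hα (-lam)
  have h1 : ∫ s in 0..t, ((t - s) ^ (α - 1) / Real.Gamma α - 1) *
      (lam * mittagLeffler α 1 (-lam * s ^ α)) =
      lam / Real.Gamma α * (∫ s in 0..t, (t - s) ^ (α - 1) * mittagLeffler α 1 (-lam * s ^ α)) -
        lam * ∫ s in 0..t, mittagLeffler α 1 (-lam * s ^ α) := by
    rw [← intervalIntegral.integral_const_mul, ← intervalIntegral.integral_const_mul,
      ← intervalIntegral.integral_sub]
    · refine intervalIntegral.integral_congr fun s _ => ?_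
      ring
    · exact ((intervalIntegrable_sub_rpow hα t 0 t).mul_continuousOn hc.continuousOn).const_mul _
    · exact (hc.intervalIntegrable _ _).const_mul _
  rw [h1, mlDefect]
  nth_rewrite 1 [mittagLeffler_eq_one_add_integral (-lam) hα ht]
  ring

/-- A majorant of `(1 - α)⁻¹ |t ^ (α - 1) / Γ(α) - 1|` on `(0, T)`, uniform in `α ∈ [α₀, 1)`. -/
noncomputable def kernelMajorant (α₀ T : ℝ) : ℝ → ℝ≥0∞ :=
  (Ioo 0 T).indicator fun t =>
    ENNReal.ofReal ((t ^ (-(1 - α₀)) + T ^ (1 - α₀) + Real.Gamma α₀) / (1 - α₀))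

theorem measurable_kernelMajorant (α₀ T : ℝ) : Measurable (kernelMajorant α₀ T) :=
  Measurable.indicator (by fun_prop) measurableSet_Ioo

theorem lintegral_kernelMajorant_rpow_lt_top {α₀ T p : ℝ} (hp : 1 ≤ p) (h : p * (1 - α₀) < 1) :
    ∫⁻ t, kernelMajorant α₀ T t ^ p < ∞ := by
  have hp0 : 0 < p := by linarith
  have hmem : MemLp
      (fun t : ℝ => (t ^ (-(1 - α₀)) + (T ^ (1 - α₀) + Real.Gamma α₀)) * (1 - α₀)⁻¹)
      (ENNReal.ofReal p) (volume.restrict (Ioo 0 T)) :=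
    ((memLp_rpow_neg_Ioo hp h).add (memLp_const _)).mul_const _
  have hfin := lintegral_rpow_enorm_lt_top_of_eLpNorm_lt_top (by simpa using hp0) (by simp) hmem.2
  rw [ENNReal.toReal_ofReal hp0.le] at hfin
  have e : ∀ t, kernelMajorant α₀ T t ^ p = (Ioo 0 T).indicator (fun t => (ENNReal.ofReal
      ((t ^ (-(1 - α₀)) + T ^ (1 - α₀) + Real.Gamma α₀) / (1 - α₀))) ^ p) t := fun t => by
    by_cases ht : t ∈ Ioo 0 T <;> simp [kernelMajorant, ht, hp0]
  simp_rw [e]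
  rw [lintegral_indicator measurableSet_Ioo]
  refine lt_of_le_of_lt (lintegral_mono fun t => ?_) hfin
  refine ENNReal.rpow_le_rpow ?_ hp0.le
  rw [← add_assoc, ← div_eq_mul_inv]
  exact Real.ofReal_le_enorm _

theorem enorm_mlDefect_le {α₀ α lam T t : ℝ} (hα₀ : 0 < α₀) (hα₀1 : α₀ < 1) (h : α₀ ≤ α)
    (h1 : α < 1) (hlam : 0 < lam) (ht : t ∈ Ioo 0 T) :
    ‖mlDefect α lam t‖ₑ ≤ ENNReal.ofReal (1 - α) * lineConv (kernelMajorant α₀ T)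
      ((Ioo 0 T).indicator fun s =>
        ENNReal.ofReal (lam * mittagLeffler α 1 (-lam * s ^ α))) t := by
  have hα : 0 < α := hα₀.trans_le h
  rw [mlDefect_eq_integral hα ht.1, enorm_neg, intervalIntegral.integral_of_le ht.1.le,
    integral_Ioc_eq_integral_Ioo]
  refine (enorm_integral_le_lintegral_enorm _).trans ?_
  rw [lineConv, ← lintegral_const_mul' _ _ ENNReal.ofReal_ne_top]
  refine (setLIntegral_mono' measurableSet_Ioo fun s hs => ?_).trans (setLIntegral_le_lintegral _ _)
  have hsT : s ∈ Ioo 0 T := ⟨hs.1, hs.2.trans ht.2⟩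
  have hts : t - s ∈ Ioo 0 T := ⟨by linarith [hs.2], by linarith [hs.1, ht.2]⟩
  have hu := mittagLeffler_neg_mul_rpow_nonneg hα h1 hlam hs.1.le
  rw [kernelMajorant, indicator_of_mem hsT, indicator_of_mem hts, enorm_mul, ← mul_assoc,
    Real.enorm_of_nonneg (mul_nonneg hlam.le hu), ← ENNReal.ofReal_mul (by linarith),
    Real.enorm_eq_ofReal_abs]
  refine mul_le_mul_left (ENNReal.ofReal_le_ofReal ?_) _
  refine (abs_rpow_div_Gamma_sub_one_le hα₀ hα₀1 h h1.le hts.1).trans ?_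
  have h2 : (t - s) ^ (1 - α₀) ≤ T ^ (1 - α₀) :=
    Real.rpow_le_rpow hts.1.le hts.2.le (by linarith)
  have h3 : 0 < 1 - α₀ := by linarith
  have h4 : 0 ≤ 1 - α := by linarith
  gcongr

theorem enorm_mlDiff_le {α lam T t : ℝ} {G : ℝ → ℝ≥0∞} {c : ℝ≥0∞} (hc : c ≠ ∞)
    (hα : 0 < α) (hlam : 0 < lam)
    (hG : ∀ s ∈ Ioo 0 T, ‖mlDefect α lam s‖ₑ ≤ c * G s) (ht : t ∈ Ioo 0 T) :
    ‖mlDiff α lam t‖ₑ ≤ c * (G t + lineConv G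
      ((Ioo 0 T).indicator fun s => ENNReal.ofReal (lam * Real.exp (-lam * s))) t) := by
  rw [mlDiff_eq_mlDefect_sub hα, mul_add]
  refine enorm_sub_le.trans (add_le_add (hG t ht) ?_)
  rw [intervalIntegral.integral_of_le ht.1.le, integral_Ioc_eq_integral_Ioo]
  refine (enorm_integral_le_lintegral_enorm _).trans ?_
  rw [lineConv_eq_lintegral_sub, ← lintegral_const_mul' _ _ hc]
  refine (setLIntegral_mono' measurableSet_Ioo fun s hs => ?_).trans (setLIntegral_le_lintegral _ _)
  have hsT : s ∈ Ioo 0 T := ⟨hs.1, hs.2.trans ht.2⟩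
  have hts : t - s ∈ Ioo 0 T := ⟨by linarith [hs.2], by linarith [hs.1, ht.2]⟩
  rw [indicator_of_mem hts, enorm_mul, Real.enorm_of_nonneg (by positivity),
    ← mul_assoc, mul_comm]
  exact mul_le_mul_left (hG s hsT) _

theorem lintegral_exp_weight_le {lam T : ℝ} (hlam : 0 < lam) :
    ∫⁻ s, (Ioo 0 T).indicator (fun s => ENNReal.ofReal (lam * Real.exp (-lam * s))) s ≤ 1 := by
  rw [lintegral_indicator measurableSet_Ioo]
  refine (lintegral_mono_set (Ioo_subset_Ioi_self : Ioo 0 T ⊆ Ioi 0)).trans ?_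
  have hint := (integrableOn_exp_mul_Ioi (neg_lt_zero.2 hlam) 0).const_mul lam
  rw [← ofReal_integral_eq_lintegral_ofReal hint (ae_of_all _ fun s => by positivity),
    integral_const_mul, integral_exp_mul_Ioi (neg_lt_zero.2 hlam)]
  simp [hlam.ne']

theorem lintegral_mittagLeffler_weight_le {α₀ α lam T : ℝ} (hα₀ : 0 < α₀) (h : α₀ ≤ α)
    (h1 : α < 1) (hlam : 0 < lam) (hT : 0 < T) :
    ∫⁻ s, (Ioo 0 T).indicator
      (fun s => ENNReal.ofReal (lam * mittagLeffler α 1 (-lam * s ^ α))) s ≤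
      ENNReal.ofReal (Real.Gamma α₀ * (1 + T)) := by
  have hα : 0 < α := hα₀.trans_le h
  have hc := continuous_mittagLeffler_rpow hα (-lam)
  have hint : IntegrableOn (fun s => lam * mittagLeffler α 1 (-lam * s ^ α)) (Ioo 0 T) volume :=
    ((intervalIntegrable_iff_integrableOn_Ioo_of_le hT.le).1 (hc.intervalIntegrable 0 T)).const_mul _
  rw [lintegral_indicator measurableSet_Ioo, ← ofReal_integral_eq_lintegral_ofReal hint]
  · refine ENNReal.ofReal_le_ofReal ?_
    rw [← integral_Ioc_eq_integral_Ioo, ← intervalIntegral.integral_of_le hT.le,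
      intervalIntegral.integral_const_mul]
    refine (mul_integral_mittagLeffler_le hα h1 hlam hT).trans ?_
    have hG : Real.Gamma α ≤ Real.Gamma α₀ :=
      Real.Gamma_strictAntiOn_Ioc.antitoneOn ⟨hα₀, h.trans h1.le⟩ ⟨hα, h1.le⟩ h
    have hT1 : T ^ (1 - α) ≤ 1 + T := by
      refine (Real.rpow_le_rpow hT.le (by linarith : T ≤ 1 + T) (by linarith)).trans ?_
      exact Real.rpow_le_self_of_one_le (by linarith) (by linarith)
    exact mul_le_mul hG hT1 (by positivity) (Real.Gamma_pos_of_pos hα₀).le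
  · filter_upwards [ae_restrict_mem measurableSet_Ioo] with s hs
    exact mul_nonneg hlam.le (mittagLeffler_neg_mul_rpow_nonneg hα h1 hlam hs.1.le)

theorem eLpNorm_eq_lintegral_rpow {p : ℝ} (hp : 0 < p) (f : ℝ → ℝ≥0∞) :
    eLpNorm f (ENNReal.ofReal p) volume = (∫⁻ t, f t ^ p) ^ (1 / p) := by
  rw [eLpNorm_eq_lintegral_rpow_enorm_toReal (by simpa using hp) (by simp),
    ENNReal.toReal_ofReal hp.le]
  simp

theorem eLpNorm_lineConv_le {p : ℝ} (hp : 1 ≤ p) {f w : ℝ → ℝ≥0∞} (hf : Measurable f)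
    (hw : Measurable w) :
    eLpNorm (lineConv f w) (ENNReal.ofReal p) volume ≤
      (∫⁻ s, w s) * eLpNorm f (ENNReal.ofReal p) volume := by
  have hp0 : 0 < p := by linarith
  rw [eLpNorm_eq_lintegral_rpow hp0, eLpNorm_eq_lintegral_rpow hp0]
  refine (ENNReal.rpow_le_rpow (lintegral_rpow_lineConv_le hp hf hw) (by positivity)).trans ?_
  rw [ENNReal.mul_rpow_of_nonneg _ _ (by positivity), ← ENNReal.rpow_mul,
    mul_one_div_cancel hp0.ne', ENNReal.rpow_one]

/-! ### Assembly of the two estimates -/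

theorem mainTheorem2 (T : ℝ) (hT : 0 < T) (α₀ : ℝ) (hα₀ : α₀ ∈ Ioo (0 : ℝ) 1)
    (p : ℝ) (hp : p ∈ Ico (1 : ℝ) (1 / (1 - α₀))) :
    ∃ C : ℝ, 0 < C ∧ ∀ lam₁ : ℝ, 0 ≤ lam₁ → ∀ α ∈ Ico α₀ 1, ∀ lam : ℝ, lam₁ < lam →
      (MemLp (mlDiff α lam) ∞ (volume.restrict (Ioo 0 T)) ∧
        eLpNorm (mlDiff α lam) ∞ (volume.restrict (Ioo 0 T)) ≤
          ENNReal.ofReal (C * lam ^ (1 / p) * (1 - α))) ∧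
      (MemLp (mlDiff α lam) (ENNReal.ofReal p) (volume.restrict (Ioo 0 T)) ∧
        eLpNorm (mlDiff α lam) (ENNReal.ofReal p) (volume.restrict (Ioo 0 T)) ≤
          ENNReal.ofReal (C * (1 - α))) := by
  obtain ⟨hα₀0, hα₀1⟩ := hα₀
  obtain ⟨hp1, hp2⟩ := hp
  have hp0 : 0 < p := by linarith
  rw [lt_div_iff₀ (by linarith)] at hp2
  set F := kernelMajorant α₀ T with hF
  have hFm : Measurable F := measurable_kernelMajorant α₀ T
  have hN : ∫⁻ t, F t ^ p ≠ ∞ := (lintegral_kernelMajorant_rpow_lt_top hp1 hp2).ne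
  set N : ℝ := (∫⁻ t, F t ^ p).toReal ^ (1 / p) with hNdef
  have hN0 : 0 ≤ N := by positivity
  have hNe : (∫⁻ t, F t ^ p) ^ (1 / p) = ENNReal.ofReal N := by
    rw [hNdef, ← ENNReal.ofReal_rpow_of_nonneg ENNReal.toReal_nonneg (by positivity),
      ENNReal.ofReal_toReal hN]
  set K : ℝ := Real.Gamma α₀ * (1 + T) with hKdef
  have hK1 : 1 ≤ K :=
    one_le_mul_of_one_le_of_one_le (Real.one_le_Gamma_of_le_one hα₀0 hα₀1.le) (by linarith)
  have hK0 : 0 ≤ K := by linarith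
  -- The factor 2 counts the defect and its exponential convolution; the `+ 1` only ensures
  -- positivity.
  refine ⟨2 * (K * N) + 1, by positivity, ?_⟩
  rintro lam₁ hlam₁ α ⟨hα, hα1⟩ lam hlam'
  have hlam : 0 < lam := hlam₁.trans_lt hlam'
  have hαpos : 0 < α := hα₀0.trans_le hα
  have hε : 0 ≤ 1 - α := by linarith
  have hcont := continuous_mittagLeffler_rpow hαpos (-lam)
  have hmeas : AEStronglyMeasurable (mlDiff α lam) (volume.restrict (Ioo 0 T)) :=
    (hcont.sub (by fun_prop : Continuous fun t => Real.exp (-lam * t))).aestronglyMeasurable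
  set w₁ : ℝ → ℝ≥0∞ := (Ioo 0 T).indicator fun s =>
    ENNReal.ofReal (lam * mittagLeffler α 1 (-lam * s ^ α)) with hw₁
  set w₂ : ℝ → ℝ≥0∞ := (Ioo 0 T).indicator fun s =>
    ENNReal.ofReal (lam * Real.exp (-lam * s)) with hw₂
  have hw₁m : Measurable w₁ :=
    (hcont.measurable.const_mul lam).ennreal_ofReal.indicator measurableSet_Ioo
  have hw₂m : Measurable w₂ := Measurable.indicator (by fun_prop) measurableSet_Ioo
  have hw₁K : ∫⁻ s, w₁ s ≤ ENNReal.ofReal K :=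
    lintegral_mittagLeffler_weight_le hα₀0 hα hα1 hlam hT
  have hw₂1 : ∫⁻ s, w₂ s ≤ 1 := lintegral_exp_weight_le hlam
  set G := lineConv F w₁ with hG
  have hGm : Measurable G := measurable_lineConv hFm hw₁m
  have hHm : Measurable (lineConv G w₂) := measurable_lineConv hGm hw₂m
  have hpt : ∀ t ∈ Ioo 0 T, ‖mlDiff α lam t‖ₑ ≤
      ENNReal.ofReal (1 - α) * (G t + lineConv G w₂ t) := fun t ht =>
    enorm_mlDiff_le ENNReal.ofReal_ne_top hαpos hlam
      (fun s hs => enorm_mlDefect_le hα₀0 hα₀1 hα hα1 hlam hs) ht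
  have hinf : eLpNorm (mlDiff α lam) ∞ (volume.restrict (Ioo 0 T)) ≤
      ENNReal.ofReal ((2 * (K * N) + 1) * lam ^ (1 / p) * (1 - α)) := by
    have hGB : ∀ t, G t ≤ ENNReal.ofReal (K * N * lam ^ (1 / p)) := by
      intro t
      have hwlam : ∀ s, w₁ s ≤ ENNReal.ofReal lam := by
        intro s
        refine indicator_apply_le' (fun hs => ENNReal.ofReal_le_ofReal ?_) fun _ => zero_le
        exact mul_le_of_le_one_right hlam.le
          (mittagLeffler_neg_mul_rpow_le_one hαpos hα1 hlam hs.1)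
      -- One factor of the weight is bounded by `λ` and the others by the mass `K`, so the `p`-th
      -- root carries `λ^(1/p)`. As `K ≥ 1`, `K^(p-1)` may be raised to `K^p`.
      have h2 : G t ^ p ≤ ENNReal.ofReal K ^ p * (ENNReal.ofReal lam * ∫⁻ s, F s ^ p) := by
        refine (rpow_lineConv_le hp1 hFm hw₁m t).trans (mul_le_mul' ?_
          (lineConv_le_mul_lintegral_left (by fun_prop) hwlam t))
        refine (ENNReal.rpow_le_rpow hw₁K (by linarith)).trans ?_
        exact ENNReal.rpow_le_rpow_of_exponent_le (by simpa using hK1) (by linarith)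
      have h3 := ENNReal.rpow_le_rpow h2 (by positivity : 0 ≤ 1 / p)
      rw [ENNReal.mul_rpow_of_nonneg _ _ (by positivity),
        ENNReal.mul_rpow_of_nonneg _ _ (by positivity), ← ENNReal.rpow_mul, ← ENNReal.rpow_mul,
        mul_one_div_cancel hp0.ne', ENNReal.rpow_one, ENNReal.rpow_one, hNe,
        ENNReal.ofReal_rpow_of_pos hlam, ← ENNReal.ofReal_mul (by positivity),
        ← ENNReal.ofReal_mul hK0] at h3
      refine h3.trans (le_of_eq ?_)
      ring_nf
    rw [eLpNorm_exponent_top]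
    refine eLpNormEssSup_le_of_ae_enorm_bound ?_
    filter_upwards [ae_restrict_mem measurableSet_Ioo] with t ht
    refine (hpt t ht).trans ?_
    have hH : lineConv G w₂ t ≤ ENNReal.ofReal (K * N * lam ^ (1 / p)) :=
      (lineConv_le_mul_lintegral_right hw₂m hGB t).trans (mul_le_of_le_one_right' hw₂1)
    refine (mul_le_mul_right (add_le_add (hGB t) hH) _).trans ?_
    rw [← ENNReal.ofReal_add (by positivity) (by positivity), ← ENNReal.ofReal_mul hε]
    refine ENNReal.ofReal_le_ofReal ?_
    have : 0 ≤ lam ^ (1 / p) * (1 - α) := by positivity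
    linarith
  have hLp : eLpNorm (mlDiff α lam) (ENNReal.ofReal p) (volume.restrict (Ioo 0 T)) ≤
      ENNReal.ofReal ((2 * (K * N) + 1) * (1 - α)) := by
    have hGp : eLpNorm G (ENNReal.ofReal p) volume ≤ ENNReal.ofReal (K * N) := by
      refine (eLpNorm_lineConv_le hp1 hFm hw₁m).trans ?_
      rw [eLpNorm_eq_lintegral_rpow hp0, hNe, ENNReal.ofReal_mul hK0]
      exact mul_le_mul_left hw₁K _
    have hHp : eLpNorm (lineConv G w₂) (ENNReal.ofReal p) volume ≤ ENNReal.ofReal (K * N) :=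
      (eLpNorm_lineConv_le hp1 hGm hw₂m).trans ((mul_le_of_le_one_left' hw₂1).trans hGp)
    have h1 : eLpNorm (mlDiff α lam) (ENNReal.ofReal p) (volume.restrict (Ioo 0 T)) ≤
        ENNReal.ofReal (1 - α) * eLpNorm (G + lineConv G w₂) (ENNReal.ofReal p)
          (volume.restrict (Ioo 0 T)) := by
      refine eLpNorm_le_mul_eLpNorm_of_ae_le_mul'' _ (hGm.add hHm).aestronglyMeasurable ?_
      filter_upwards [ae_restrict_mem measurableSet_Ioo] with t ht
      simpa using hpt t ht
    have h2 : eLpNorm (G + lineConv G w₂) (ENNReal.ofReal p) (volume.restrict (Ioo 0 T)) ≤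
        ENNReal.ofReal (K * N) + ENNReal.ofReal (K * N) :=
      (eLpNorm_mono_measure _ Measure.restrict_le_self).trans
        ((eLpNorm_add_le hGm.aestronglyMeasurable hHm.aestronglyMeasurable
          (by simpa using hp1)).trans (add_le_add hGp hHp))
    refine h1.trans ((mul_le_mul_right h2 _).trans ?_)
    rw [← ENNReal.ofReal_add (by positivity) (by positivity), ← ENNReal.ofReal_mul hε]
    refine ENNReal.ofReal_le_ofReal ?_
    linarith
  exact ⟨⟨⟨hmeas, hinf.trans_lt ENNReal.ofReal_lt_top⟩, hinf⟩,
    ⟨⟨hmeas, hLp.trans_lt ENNReal.ofReal_lt_top⟩, hLp⟩⟩
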